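/- Let $\mathcal X,\mathcal U,\mathcal Y$ be separable complex Pontryagin spaces such that $\mathcal U$ and $\mathcal Y$ have the same (finite) negative index, and let $\kappa$ be the negative index of $\mathcal X$. Orthogonal sums $\oplus$, adjoints and contractions are taken with respect to the indefinite inner products, and boundedness with respect to the strong topologies. Let $\Sigma=(A,B,C,D;\mathcal X,\mathcal U,\mathcal Y;\kappa)$ be a passive system: $A,B,C,D$ are bounded operators such that the system operator $$T=\begin{pmatrix}A&B\\ C&D\end{pmatrix}:\mathcal X\oplus\mathcal U\to\mathcal X\oplus\mathcal Y$$ is a contraction, i.e. $\langle Th,Th\rangle\le\langle h,h\rangle$ for all $h$. Then $\Sigma$ has a conservative dilation $\widehat\Sigma=(\widehat A,\widehat B,\widehat C,D;\widehat{\mathcal X},\mathcal U,\mathcal Y;\kappa)$ with the same feedthrough operator $D$ and with the state space $$\widehat{\mathcal X}=\ell^2(\mathfrak D_T)\oplus\mathcal X\oplus\ell^2(\mathfrak D_{T^*}),$$ where $\mathfrak D_T$ and $\mathfrak D_{T^*}$ are defect spaces of $T$ and $T^*$. In detail: there are Hilbert spaces $\mathfrak D_T,\mathfrak D_{T^*}$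 and bounded operators $D_T:\mathfrak D_T\to\mathcal X\oplus\mathcal U$ and $D_{T^*}:\mathfrak D_{T^*}\to\mathcal X\oplus\mathcal Y$ with zero kernels such that $I-T^*T=D_TD_T^*$ and $I-TT^*=D_{T^*}D_{T^*}^*$; the space $\widehat{\mathcal X}$ above, with $\mathcal D=\ell^2(\mathfrak D_T)$ and $\mathcal D_*=\ell^2(\mathfrak D_{T^*})$ (Hilbert spaces of square-summable sequences), is a separable Pontryagin space of negative index $\kappa$; and there are bounded operators $\widehat A:\widehat{\mathcal X}\to\widehat{\mathcal X}$, $\widehat B:\mathcal U\to\widehat{\mathcal X}$, $\widehat C:\widehat{\mathcal X}\to\mathcal Y$ with $$P_{\mathcal X}\widehat A{\upharpoonright}_{\mathcal X}=A,\quad P_{\mathcal X}\widehat B=B,\quad \widehat C{\upharpoonright}_{\mathcal X}=C,\quad \widehat A\mathcal D\subset\mathcal D,\quad \widehat C\mathcal D=\{0\},\quad \widehat A^*\mathcal D_*\subset\mathcal D_*,\quad \widehat B^*\mathcal D_*=\{0\},$$ such that the system operator $\begin{pmatrix}\widehat A&\widehat B\\ \widehat C&D\end{pmatrix}:\widehat{\mathcal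 X}\oplus\mathcal U\to\widehat{\mathcal X}\oplus\mathcal Y$ is unitary (its products with its adjoint in both orders are the identity). -/

import Mathlib

universe u v w

noncomputable section

open scoped ComplexConjugate
open InnerProductSpace

/-! ### Pontryagin spaces

The topology of a Pontryagin space is its strong topology, i.e. the one induced by a fundamental
decomposition.  It is represented by an arbitrary norm inducing it, so that bounded operators are
Mathlib's continuous linear maps. As for Mathlib's `inner`, the inner product is conjugate linear in
the first variable. -/

/-- `X = P ⊕ N` is a fundamental decomposition of the complex inner product space `(X, ip)`, and
the norm of `X` is equivalent to the norm `‖p + n‖² = ip p p - ip n n` which it induces. The bounds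
say in particular that `ip` is positive definite on `P` (take `n = 0`) and negative definite on `N`
(take `p = 0`); if `X` is complete, then `(P, ip)` and `(N, -ip)` are Hilbert spaces. -/
structure IsFundamentalDecomposition {X : Type*} [NormedAddCommGroup X] [NormedSpace ℂ X]
    (ip : X →ₗ⋆[ℂ] X →ₗ[ℂ] ℂ) (P N : Submodule ℂ X) : Prop where
  isCompl : IsCompl P N
  orthogonal : ∀ p ∈ P, ∀ n ∈ N, ip p n = 0
  strong_norm : ∃ c C : ℝ, 0 < c ∧ ∀ p ∈ P, ∀ n ∈ N,
    c * ‖p + n‖ ^ 2 ≤ (ip p p).re - (ip n n).re ∧ (ip p p).re - (ip n n).re ≤ C * ‖p + n‖ ^ 2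

/-- A complex Pontryagin space: a space with a Hermitian inner product admitting a
fundamental decomposition `P ⊕ N` with `P` a Hilbert space and `N` a finite-dimensional anti-Hilbert
space, with its strong topology. -/
class PontryaginSpace (X : Type*) [NormedAddCommGroup X] [NormedSpace ℂ X] [CompleteSpace X] where
  /-- the indefinite inner product -/
  ip : X →ₗ⋆[ℂ] X →ₗ[ℂ] ℂ
  conj_symm : ∀ x y, conj (ip y x) = ip x y
  exists_decomposition : ∃ P N : Submodule ℂ X,
    IsFundamentalDecomposition ip P N ∧ FiniteDimensional ℂ N

namespace PontryaginSpace

/-- The negative index of the Pontryagin space `X` is `κ`, i.e. the negative component of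
a fundamental decomposition of `X` has dimension `κ`. -/
def HasNegativeIndex (X : Type*) [NormedAddCommGroup X] [NormedSpace ℂ X] [CompleteSpace X]
    [PontryaginSpace X] (κ : ℕ) : Prop :=
  ∃ P N : Submodule ℂ X, IsFundamentalDecomposition (ip : X →ₗ⋆[ℂ] X →ₗ[ℂ] ℂ) P N ∧
    FiniteDimensional ℂ N ∧ Module.finrank ℂ N = κ

/-- A Hilbert space is a Pontryagin space (of negative index `0`). -/
instance ofHilbert (H : Type*) [NormedAddCommGroup H] [InnerProductSpace ℂ H] [CompleteSpace H] :
    PontryaginSpace H where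
  ip := innerₛₗ ℂ
  conj_symm x y := by simp
  exists_decomposition := by
    refine ⟨⊤, ⊥, ⟨isCompl_top_bot, ?_, 1, 1, one_pos, ?_⟩, inferInstance⟩
    · rintro p - n hn
      rw [(Submodule.mem_bot ℂ).1 hn, map_zero]
    · rintro p - n hn
      rw [(Submodule.mem_bot ℂ).1 hn]
      have e : (((‖p‖ : ℂ)) ^ 2).re = ‖p‖ ^ 2 := by norm_cast
      simp [e]

section Prod

variable {X Y : Type*} [NormedAddCommGroup X] [NormedSpace ℂ X]
  [NormedAddCommGroup Y] [NormedSpace ℂ Y]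

/-- The inner product `⟨(x, y), (x', y')⟩ = ⟨x, x'⟩ + ⟨y, y'⟩` of an orthogonal direct sum. -/
def prodForm (f : X →ₗ⋆[ℂ] X →ₗ[ℂ] ℂ) (g : Y →ₗ⋆[ℂ] Y →ₗ[ℂ] ℂ) :
    (X × Y) →ₗ⋆[ℂ] (X × Y) →ₗ[ℂ] ℂ :=
  LinearMap.mk₂'ₛₗ (starRingEnd ℂ) (RingHom.id ℂ) (fun v w => f v.1 w.1 + g v.2 w.2)
    (fun _ _ _ => by simp; ring) (fun _ _ _ => by simp; ring)
    (fun _ _ _ => by simp; ring) (fun _ _ _ => by simp; ring)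

theorem prodForm_apply (f : X →ₗ⋆[ℂ] X →ₗ[ℂ] ℂ) (g : Y →ₗ⋆[ℂ] Y →ₗ[ℂ] ℂ) (v w : X × Y) :
    prodForm f g v w = f v.1 w.1 + g v.2 w.2 :=
  rfl

theorem isFundamentalDecomposition_prod {f : X →ₗ⋆[ℂ] X →ₗ[ℂ] ℂ} {g : Y →ₗ⋆[ℂ] Y →ₗ[ℂ] ℂ}
    {P N : Submodule ℂ X} {P' N' : Submodule ℂ Y}
    (h : IsFundamentalDecomposition f P N) (h' : IsFundamentalDecomposition g P' N') :
    IsFundamentalDecomposition (prodForm f g) (P.prod P') (N.prod N') := by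
  refine ⟨⟨?_, ?_⟩, ?_, ?_⟩
  · rw [disjoint_iff, Submodule.prod_inf_prod, h.isCompl.inf_eq_bot, h'.isCompl.inf_eq_bot,
      Submodule.prod_bot]
  · rw [codisjoint_iff, Submodule.prod_sup_prod, h.isCompl.sup_eq_top, h'.isCompl.sup_eq_top,
      Submodule.prod_top]
  · rintro ⟨p, p'⟩ ⟨hp, hp'⟩ ⟨n, n'⟩ ⟨hn, hn'⟩
    rw [prodForm_apply, h.orthogonal p hp n hn, h'.orthogonal p' hp' n' hn', add_zero]
  · obtain ⟨c, C, hc, hb⟩ := h.strong_norm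
    obtain ⟨c', C', hc', hb'⟩ := h'.strong_norm
    refine ⟨min c c', |C| + |C'|, lt_min hc hc', ?_⟩
    rintro ⟨p, p'⟩ ⟨hp, hp'⟩ ⟨n, n'⟩ ⟨hn, hn'⟩
    obtain ⟨h1, h2⟩ := hb p hp n hn
    obtain ⟨h3, h4⟩ := hb' p' hp' n' hn'
    simp only [prodForm_apply, Complex.add_re, Prod.mk_add_mk, Prod.norm_mk]
    have e1 : ‖p + n‖ ^ 2 ≤ max ‖p + n‖ ‖p' + n'‖ ^ 2 := by gcongr; exact le_max_left _ _
    have e2 : ‖p' + n'‖ ^ 2 ≤ max ‖p + n‖ ‖p' + n'‖ ^ 2 := by gcongr; exact le_max_right _ _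
    constructor
    · have e3 : max ‖p + n‖ ‖p' + n'‖ ^ 2 ≤ ‖p + n‖ ^ 2 + ‖p' + n'‖ ^ 2 := by
        rcases max_choice ‖p + n‖ ‖p' + n'‖ with e | e <;> rw [e] <;>
          nlinarith [sq_nonneg ‖p + n‖, sq_nonneg ‖p' + n'‖]
      have e4 := mul_le_mul_of_nonneg_left e3 (lt_min hc hc').le
      have e5 := mul_le_mul_of_nonneg_right (min_le_left c c') (sq_nonneg ‖p + n‖)
      have e6 := mul_le_mul_of_nonneg_right (min_le_right c c') (sq_nonneg ‖p' + n'‖)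
      linarith
    · have e3 := mul_le_mul (le_abs_self C) e1 (sq_nonneg _) (abs_nonneg C)
      have e4 := mul_le_mul (le_abs_self C') e2 (sq_nonneg _) (abs_nonneg C')
      linarith

/-- The orthogonal direct sum of two Pontryagin spaces. -/
instance [CompleteSpace X] [CompleteSpace Y] [PontryaginSpace X] [PontryaginSpace Y] :
    PontryaginSpace (X × Y) where
  ip := prodForm ip ip
  conj_symm v w := by
    rw [prodForm_apply, prodForm_apply, map_add, conj_symm, conj_symm]
  exists_decomposition := by
    obtain ⟨P, N, h, hN⟩ := exists_decomposition (X := X)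
    obtain ⟨P', N', h', hN'⟩ := exists_decomposition (X := Y)
    refine ⟨_, _, isFundamentalDecomposition_prod h h', ?_⟩
    rw [FiniteDimensional, Module.Finite.iff_fg] at *
    exact hN.prod hN'

end Prod

/-! ### The adjoint with respect to the indefinite inner products -/

theorem exists_ofCore {V : Type u} [AddCommGroup V] [Module ℂ V] (core : InnerProductSpace.Core ℂ V) :
    ∃ (H : Type u) (_ : NormedAddCommGroup H) (_ : InnerProductSpace ℂ H) (f : V ≃ₗ[ℂ] H),
      ∀ x y, inner ℂ (f x) (f y) = core.inner x y :=
  letI : NormedAddCommGroup V := core.toNormedAddCommGroup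
  letI : InnerProductSpace ℂ V := InnerProductSpace.ofCore core.toCore
  ⟨V, inferInstance, inferInstance, LinearEquiv.refl ℂ V, fun _ _ => rfl⟩

/-- A Pontryagin space is a Hilbert space `H` with the inner product `⟪J x, y⟫`, `J² = 1`. -/
theorem exists_hilbert (X : Type u) [NormedAddCommGroup X] [NormedSpace ℂ X] [CompleteSpace X]
    [PontryaginSpace X] :
    ∃ (H : Type u) (_ : NormedAddCommGroup H) (_ : InnerProductSpace ℂ H) (_ : CompleteSpace H)
      (e : X ≃L[ℂ] H) (J : H →L[ℂ] H), (∀ z, J (J z) = z) ∧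
        ∀ x y : X, ip x y = inner ℂ (J (e x)) (e y) := by
  obtain ⟨P, N, h, -⟩ := exists_decomposition (X := X)
  obtain ⟨c, C, hc, hb⟩ := h.strong_norm
  let a : X →ₗ[ℂ] X := P.projection N h.isCompl
  let b : X →ₗ[ℂ] X := N.projection P h.isCompl.symm
  have haP : ∀ x, a x ∈ P := fun x => Submodule.projection_apply_mem _ x
  have hbN : ∀ x, b x ∈ N := fun x => Submodule.projection_apply_mem _ x
  have hab : ∀ x, a x + b x = x := Submodule.projection_add_projection_eq_self h.isCompl
  have haa : ∀ x, a (a x) = a x := fun x => Submodule.projection_apply_left h.isCompl ⟨a x, haP x⟩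
  have hbb : ∀ x, b (b x) = b x := fun x =>
    Submodule.projection_apply_left h.isCompl.symm ⟨b x, hbN x⟩
  have hab0 : ∀ x, a (b x) = 0 := fun x => Submodule.projection_apply_right h.isCompl ⟨b x, hbN x⟩
  have hba0 : ∀ x, b (a x) = 0 := fun x =>
    Submodule.projection_apply_right h.isCompl.symm ⟨a x, haP x⟩
  have hlow : ∀ x, c * ‖x‖ ^ 2 ≤ (ip (a x) (a x) - ip (b x) (b x)).re := fun x => by
    simpa [hab] using (hb _ (haP x) _ (hbN x)).1
  have hup : ∀ x, (ip (a x) (a x) - ip (b x) (b x)).re ≤ C * ‖x‖ ^ 2 := fun x => by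
    simpa [hab] using (hb _ (haP x) _ (hbN x)).2
  let core : InnerProductSpace.Core ℂ X :=
    { inner := fun x y => ip (a x) (a y) - ip (b x) (b y)
      conj_inner_symm := fun x y => by simp only [map_sub, conj_symm]
      re_inner_nonneg := fun x => le_trans (by positivity) (hlow x)
      add_left := fun x y z => by simp only [map_add, LinearMap.add_apply]; ring
      smul_left := fun x y r => by
        simp only [map_smul, LinearMap.map_smulₛₗ, LinearMap.smul_apply, smul_eq_mul]; ring
      definite := fun x hx => by
        have h0 := hlow x
        rw [show ip (a x) (a x) - ip (b x) (b x) = 0 from hx, Complex.zero_re] at h0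
        have h1 : ‖x‖ ^ 2 ≤ 0 := nonpos_of_mul_nonpos_right h0 hc
        have h2 : ‖x‖ = 0 := by nlinarith [norm_nonneg x]
        exact norm_eq_zero.1 h2 }
  obtain ⟨H, _, _, f, hf⟩ := exists_ofCore core
  have hn : ∀ x, ‖f x‖ ^ 2 = (ip (a x) (a x) - ip (b x) (b x)).re := fun x => by
    rw [← show core.inner x x = ip (a x) (a x) - ip (b x) (b x) from rfl, ← hf x x]
    exact norm_sq_eq_re_inner (𝕜 := ℂ) (f x)
  let e : X ≃L[ℂ] H := f.toContinuousLinearEquivOfBounds (√|C|) (√c)⁻¹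
    (fun x => by
      refine abs_le_of_sq_le_sq' ?_ (by positivity) |>.2
      rw [hn, mul_pow, Real.sq_sqrt (abs_nonneg C)]
      exact (hup x).trans (by gcongr; exact le_abs_self C))
    (fun y => by
      obtain ⟨x, rfl⟩ := f.surjective y
      rw [f.symm_apply_apply, ← div_eq_inv_mul, le_div_iff₀ (Real.sqrt_pos.2 hc)]
      refine abs_le_of_sq_le_sq' ?_ (by positivity) |>.2
      rw [hn, mul_pow, Real.sq_sqrt hc.le, mul_comm]
      exact hlow x)
  have he : ∀ x, e x = f x := fun _ => rfl
  have hJ2 : ∀ x, (a - b) ((a - b) x) = x := fun x => by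
    simp only [LinearMap.sub_apply, map_sub, haa, hbb, hab0, hba0]
    simpa using hab x
  have hJn : ∀ x, ‖f ((a - b) x)‖ = ‖f x‖ := fun x => by
    refine (sq_eq_sq₀ (norm_nonneg _) (norm_nonneg _)).1 ?_
    rw [hn, hn]
    simp [haa, hbb, hab0, hba0]
  have hcH : CompleteSpace H := (completeSpace_congr (e := e.toEquiv) e.isUniformEmbedding).1
    inferInstance
  let J : H →L[ℂ] H := (f.toLinearMap ∘ₗ (a - b) ∘ₗ f.symm.toLinearMap).mkContinuous 1
    (fun y => by
      obtain ⟨x, rfl⟩ := f.surjective y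
      rw [one_mul]
      exact (by simpa using (hJn x).le))
  have hJ : ∀ x, J (f x) = f ((a - b) x) := fun x => by
    change f ((a - b) (f.symm (f x))) = _
    rw [f.symm_apply_apply]
  refine ⟨H, _, _, hcH, e, J, fun z => ?_, fun x y => ?_⟩
  · obtain ⟨x, rfl⟩ := f.surjective z
    rw [hJ, hJ, hJ2]
  · rw [he, he, hJ, hf]
    change _ = ip (a ((a - b) x)) (a y) - ip (b ((a - b) x)) (b y)
    have h1 : ip (a x) (b y) = 0 := h.orthogonal _ (haP x) _ (hbN y)
    have h2 : ip (b x) (a y) = 0 := by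
      rw [← conj_symm, h.orthogonal _ (haP y) _ (hbN x), map_zero]
    conv_lhs => rw [← hab x, ← hab y]
    simp [haa, hbb, hab0, hba0, h1, h2]

section Adjoint

variable {X Y : Type*} [NormedAddCommGroup X] [NormedSpace ℂ X] [CompleteSpace X]
  [PontryaginSpace X] [NormedAddCommGroup Y] [NormedSpace ℂ Y] [CompleteSpace Y]
  [PontryaginSpace Y]

theorem exists_adj (T : X →L[ℂ] Y) :
    ∃ S : Y →L[ℂ] X, ∀ x y, ip (T x) y = ip x (S y) := by
  obtain ⟨H, _, _, _, e, J, hJ, hip⟩ := exists_hilbert X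
  obtain ⟨H', _, _, _, e', J', hJ', hip'⟩ := exists_hilbert Y
  have hsymm : ∀ z w : H', inner ℂ (J' z) w = inner ℂ z (J' w) := fun z w => by
    have h1 := hip' (e'.symm z) (e'.symm w)
    have h2 := hip' (e'.symm w) (e'.symm z)
    rw [e'.apply_symm_apply, e'.apply_symm_apply] at h1 h2
    rw [← h1, ← conj_symm, h2, inner_conj_symm]
  have hsymm' : ∀ z w : H, inner ℂ (J z) w = inner ℂ z (J w) := fun z w => by
    have h1 := hip (e.symm z) (e.symm w)
    have h2 := hip (e.symm w) (e.symm z)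
    rw [e.apply_symm_apply, e.apply_symm_apply] at h1 h2
    rw [← h1, ← conj_symm, h2, inner_conj_symm]
  let T' : H →L[ℂ] H' := e'.toContinuousLinearMap ∘L T ∘L e.symm.toContinuousLinearMap
  refine ⟨e.symm.toContinuousLinearMap ∘L J ∘L ContinuousLinearMap.adjoint T' ∘L J' ∘L
    e'.toContinuousLinearMap, fun x y => ?_⟩
  have hT : T' (e x) = e' (T x) := by simp [T']
  simp only [hip, hip', ContinuousLinearMap.comp_apply, ContinuousLinearEquiv.coe_coe,
    e.apply_symm_apply]
  rw [hsymm', hJ, ContinuousLinearMap.adjoint_inner_right, hT, hsymm]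

/-- The adjoint of a bounded operator with respect to the indefinite inner products. -/
def adj (T : X →L[ℂ] Y) : Y →L[ℂ] X :=
  Classical.choose (exists_adj T)

theorem ip_adj (T : X →L[ℂ] Y) (x : X) (y : Y) : ip (T x) y = ip x (adj T y) :=
  Classical.choose_spec (exists_adj T) x y

/-- The inner product is nondegenerate. -/
theorem eq_of_ip_eq {y z : X} (h : ∀ x : X, ip x y = ip x z) : y = z := by
  obtain ⟨H, _, _, _, e, J, hJ, hip⟩ := exists_hilbert X
  refine e.injective (ext_inner_left ℂ fun w => ?_)
  simpa [hip, hJ] using h (e.symm (J w))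

theorem adj_unique {T : X →L[ℂ] Y} {S : Y →L[ℂ] X} (h : ∀ x y, ip (T x) y = ip x (S y)) :
    adj T = S :=
  ContinuousLinearMap.ext fun y => eq_of_ip_eq fun x => by rw [← ip_adj, h]

/-- `T` is a contraction: `⟨T x, T x⟩ ≤ ⟨x, x⟩` (these numbers are real). -/
def IsContractive (T : X →L[ℂ] Y) : Prop :=
  ∀ x, (ip (T x) (T x)).re ≤ (ip x x).re

/-- `T` is isometric: `T* T = I`. -/
def IsIsometric (T : X →L[ℂ] Y) : Prop :=
  adj T ∘L T = ContinuousLinearMap.id ℂ X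

/-- `T` is co-isometric: `T T* = I`. -/
def IsCoisometric (T : X →L[ℂ] Y) : Prop :=
  T ∘L adj T = ContinuousLinearMap.id ℂ Y

/-- `T` is unitary: `T* T = I` and `T T* = I`. -/
def IsUnitary (T : X →L[ℂ] Y) : Prop :=
  IsIsometric T ∧ IsCoisometric T

/-- `E : 𝔇 → X` is a defect operator of `T`, with the Hilbert space `𝔇` as defect space:
`E` has zero kernel and `I - T* T = E E*`. -/
def IsDefectOperator {𝔇 : Type*} [NormedAddCommGroup 𝔇] [InnerProductSpace ℂ 𝔇]
    [CompleteSpace 𝔇] (T : X →L[ℂ] Y) (E : 𝔇 →L[ℂ] X) : Prop :=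
  Function.Injective E ∧ ContinuousLinearMap.id ℂ X - adj T ∘L T = E ∘L adj E

end Adjoint

end PontryaginSpace

/-! ### Systems -/

open PontryaginSpace

/-- A linear discrete time system `(A, B, C, D; X, U, Y)`: state space `X`, incoming
space `U`, outgoing space `Y`. -/
structure LinSystem (X U Y : Type*) [NormedAddCommGroup X] [NormedSpace ℂ X]
    [NormedAddCommGroup U] [NormedSpace ℂ U] [NormedAddCommGroup Y] [NormedSpace ℂ Y] where
  /-- main operator -/
  A : X →L[ℂ] X
  /-- control operator -/
  B : U →L[ℂ] X
  /-- observation operator -/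
  C : X →L[ℂ] Y
  /-- feedthrough operator -/
  D : U →L[ℂ] Y

namespace LinSystem

variable {X U Y : Type*} [NormedAddCommGroup X] [NormedSpace ℂ X] [CompleteSpace X]
  [PontryaginSpace X] [NormedAddCommGroup U] [NormedSpace ℂ U] [CompleteSpace U]
  [PontryaginSpace U] [NormedAddCommGroup Y] [NormedSpace ℂ Y] [CompleteSpace Y]
  [PontryaginSpace Y]

/-- The system operator `(x, u) ↦ (A x + B u, C x + D u)`, from `X ⊕ U` to `X ⊕ Y`. -/
def op (S : LinSystem X U Y) : X × U →L[ℂ] X × Y :=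
  (S.A.coprod S.B).prod (S.C.coprod S.D)

/-- A system is passive if its system operator is a contraction. -/
def IsPassive (S : LinSystem X U Y) : Prop :=
  IsContractive S.op

/-- A system is conservative if its system operator is unitary. -/
def IsConservative (S : LinSystem X U Y) : Prop :=
  IsUnitary S.op

/-- `S'` is a dilation of the system `S`: its state space is an orthogonal sum `𝒟 ⊕ X ⊕ 𝒟'` with
Hilbert spaces `𝒟` and `𝒟'`, its feedthrough operator is that of `S`, its other operators compress
to those of `S`, and `Â 𝒟 ⊆ 𝒟`, `Ĉ 𝒟 = {0}`, `Â* 𝒟' ⊆ 𝒟'`, `B̂* 𝒟' = {0}`. -/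
structure IsDilation {𝒟 𝒟' : Type*} [NormedAddCommGroup 𝒟] [InnerProductSpace ℂ 𝒟]
    [CompleteSpace 𝒟] [NormedAddCommGroup 𝒟'] [InnerProductSpace ℂ 𝒟'] [CompleteSpace 𝒟']
    (S' : LinSystem (𝒟 × X × 𝒟') U Y) (S : LinSystem X U Y) : Prop where
  A_compress : ∀ x : X, (S'.A (0, x, 0)).2.1 = S.A x
  B_compress : ∀ u : U, (S'.B u).2.1 = S.B u
  C_restrict : ∀ x : X, S'.C (0, x, 0) = S.C x
  D_eq : S'.D = S.D
  A_invariant : ∀ d : 𝒟, ∃ d₁ : 𝒟, S'.A (d, 0, 0) = (d₁, 0, 0)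
  C_vanish : ∀ d : 𝒟, S'.C (d, 0, 0) = 0
  adj_A_invariant : ∀ d : 𝒟', ∃ d₁ : 𝒟', adj S'.A (0, 0, d) = (0, 0, d₁)
  adj_B_vanish : ∀ d : 𝒟', adj S'.B (0, 0, d) = 0

end LinSystem

/-- The Hilbert space `ℓ²(𝔇)` of square summable sequences in the Hilbert space `𝔇`. -/
abbrev EllTwo (𝔇 : Type*) [NormedAddCommGroup 𝔇] : Type _ :=
  lp (fun _ : ℕ => 𝔇) 2

end

noncomputable section

open scoped ComplexConjugate
open InnerProductSpace

/-! Let `T` be the system operator. Contractivity makes `I - T*T` positive for the indefinite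
product, so composing with a fundamental symmetry gives a positive Hilbert space operator, whose
factorization yields the defect operator `E` (`exists_factorization_of_nonneg`). Since `X ⊕ U` and
`X ⊕ Y` have the same negative index, `T*` is a contraction too (`IsContractive.adj`), which gives
`E'` with `I - TT* = E'E'*`.

A suitable `L` makes `[[T, E'], [E*, L]]` unitary (`IsDefectOperator.exists_julia`). Its extra input
is then read from the first entry of a backward shift on `ℓ²(𝔇')`, and its extra output is stored in
the free first entry of a forward shift on `ℓ²(𝔇)`. This coupling loses nothing, hence stays
unitary, and the one-sided flow gives the dilation conditions (`exists_dilation_of_julia`). The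
added spaces are Hilbert spaces, so the negative index remains `κ`. -/

theorem IsFundamentalDecomposition.re_nonneg {X : Type*} [NormedAddCommGroup X]
    [NormedSpace ℂ X] {f : X →ₗ⋆[ℂ] X →ₗ[ℂ] ℂ} {P N : Submodule ℂ X}
    (h : IsFundamentalDecomposition f P N) {p : X} (hp : p ∈ P) : 0 ≤ (f p p).re := by
  obtain ⟨c, C, hc, hb⟩ := h.strong_norm
  have h1 := (hb p hp 0 N.zero_mem).1
  simp only [add_zero, map_zero, Complex.zero_re, sub_zero] at h1
  exact le_trans (by positivity) h1

theorem IsFundamentalDecomposition.re_neg {X : Type*} [NormedAddCommGroup X]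
    [NormedSpace ℂ X] {f : X →ₗ⋆[ℂ] X →ₗ[ℂ] ℂ} {P N : Submodule ℂ X}
    (h : IsFundamentalDecomposition f P N) {n : X} (hn : n ∈ N) (h0 : n ≠ 0) : (f n n).re < 0 := by
  obtain ⟨c, C, hc, hb⟩ := h.strong_norm
  have h1 := (hb 0 P.zero_mem n hn).1
  simp only [zero_add, map_zero, Complex.zero_re, zero_sub] at h1
  have : 0 < c * ‖n‖ ^ 2 := by positivity
  linarith

/-! ### Adjoints and factorization of positive operators -/

namespace PontryaginSpace

section Adjoint

variable {X Y : Type*} [NormedAddCommGroup X] [NormedSpace ℂ X] [CompleteSpace X]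
  [PontryaginSpace X] [NormedAddCommGroup Y] [NormedSpace ℂ Y] [CompleteSpace Y]
  [PontryaginSpace Y]

theorem ip_adj_left (T : X →L[ℂ] Y) (y : Y) (x : X) : ip (adj T y) x = ip y (T x) := by
  rw [← conj_symm, ← ip_adj, conj_symm]

theorem adj_adj (T : X →L[ℂ] Y) : adj (adj T) = T :=
  adj_unique fun y x => ip_adj_left T y x

theorem ip_prod (v w : X × Y) : ip v w = ip v.1 w.1 + ip v.2 w.2 :=
  rfl

theorem ip_hilbert {H : Type*} [NormedAddCommGroup H] [InnerProductSpace ℂ H] [CompleteSpace H]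
    (x y : H) : ip (self := ofHilbert H) x y = inner ℂ x y :=
  rfl

theorem adj_hilbert {H K : Type*} [NormedAddCommGroup H] [InnerProductSpace ℂ H] [CompleteSpace H]
    [NormedAddCommGroup K] [InnerProductSpace ℂ K] [CompleteSpace K] (T : H →L[ℂ] K) :
    adj T = ContinuousLinearMap.adjoint T :=
  adj_unique fun x y => by
    rw [ip_hilbert, ip_hilbert, ContinuousLinearMap.adjoint_inner_right]

/-- A bounded operator which is positive with respect to the indefinite inner product factors as
`E E*` with an injective operator `E` on a Hilbert space. -/
theorem exists_factorization_of_nonneg {X : Type u} [NormedAddCommGroup X] [NormedSpace ℂ X]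
    [CompleteSpace X] [PontryaginSpace X] [TopologicalSpace.SeparableSpace X] (G : X →L[ℂ] X)
    (hsymm : ∀ x y, ip (G x) y = ip x (G y)) (hpos : ∀ x, 0 ≤ (ip (G x) x).re) :
    ∃ (𝔇 : Type u) (_ : NormedAddCommGroup 𝔇) (_ : InnerProductSpace ℂ 𝔇) (_ : CompleteSpace 𝔇)
      (E : 𝔇 →L[ℂ] X), TopologicalSpace.SeparableSpace 𝔇 ∧ Function.Injective E ∧
        G = E ∘L adj E := by
  obtain ⟨H, _, _, _, e, J, hJ, hip⟩ := exists_hilbert X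
  have hJs : ∀ z w : H, inner ℂ (J z) w = inner ℂ z (J w) := fun z w => by
    have h1 := hip (e.symm z) (e.symm w)
    have h2 := hip (e.symm w) (e.symm z)
    rw [e.apply_symm_apply, e.apply_symm_apply] at h1 h2
    rw [← h1, ← conj_symm, h2, inner_conj_symm]
  -- Multiplying by `J` turns the indefinite form of `G` into a Hilbert space form.
  let Q : H →L[ℂ] H := J ∘L e.toContinuousLinearMap ∘L G ∘L e.symm.toContinuousLinearMap
  have hQ : ∀ z w, inner ℂ (Q z) w = ip (G (e.symm z)) (e.symm w) := fun z w => by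
    simp [Q, hip]
  have hQpos : 0 ≤ Q := by
    rw [ContinuousLinearMap.nonneg_iff_isPositive, ContinuousLinearMap.isPositive_def']
    refine ⟨?_, fun z => ?_⟩
    · rw [ContinuousLinearMap.isSelfAdjoint_iff_isSymmetric]
      intro z w
      change inner ℂ (Q z) w = inner ℂ z (Q w)
      rw [hQ, hsymm, ← inner_conj_symm, hQ, conj_symm]
    · rw [ContinuousLinearMap.reApplyInnerSelf_apply, hQ]
      exact hpos _
  obtain ⟨R, hR⟩ := CStarAlgebra.nonneg_iff_eq_star_mul_self.1 hQpos
  have hR' : ∀ z, ContinuousLinearMap.adjoint R (R z) = Q z := fun z => by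
    rw [hR]; rfl
  -- With `Q = R*R`, cutting down to `(ker R*)ᗮ` makes `R*` injective and still contains the range
  -- of `R`.
  let K : Submodule ℂ H := (LinearMap.ker (ContinuousLinearMap.adjoint R).toLinearMap)ᗮ
  have hK : CompleteSpace K := inferInstance
  have hRK : ∀ z, R z ∈ K := fun z => (Submodule.mem_orthogonal _ _).2 fun k hk => by
    rw [← ContinuousLinearMap.adjoint_inner_left, show ContinuousLinearMap.adjoint R k = 0 from hk,
      inner_zero_left]
  let E : K →L[ℂ] X :=
    e.symm.toContinuousLinearMap ∘L J ∘L ContinuousLinearMap.adjoint R ∘L K.subtypeL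
  have hE : ∀ k : K, E k = e.symm (J (ContinuousLinearMap.adjoint R k)) := fun _ => rfl
  have hE' : ∀ x, adj E x = ⟨R (e x), hRK _⟩ := fun x => eq_of_ip_eq fun k => by
    rw [← ip_adj, hip, hE, e.apply_symm_apply, hJ, ContinuousLinearMap.adjoint_inner_left]
    rfl
  refine ⟨K, inferInstance, inferInstance, hK, E, ?_, ?_, ?_⟩
  · have : TopologicalSpace.SeparableSpace H :=
      e.surjective.denseRange.separableSpace e.continuous
    have : SecondCountableTopology H := UniformSpace.secondCountable_of_separable H
    infer_instance
  · refine (injective_iff_map_eq_zero E).2 fun k hk => ?_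
    rw [hE, e.symm.map_eq_zero_iff] at hk
    have h0 : ContinuousLinearMap.adjoint R (k : H) = 0 := by
      rw [← hJ (ContinuousLinearMap.adjoint R (k : H)), hk, map_zero]
    have h1 := (Submodule.mem_orthogonal _ _).1 k.2 k h0
    exact Subtype.ext (inner_self_eq_zero.1 h1)
  · ext x
    rw [ContinuousLinearMap.comp_apply, hE', hE, hR']
    simp [Q, hJ]

/-- A contraction with separable domain has a separable defect space. -/
theorem IsContractive.exists_isDefectOperator {X : Type u} [NormedAddCommGroup X]
    [NormedSpace ℂ X] [CompleteSpace X] [PontryaginSpace X] [TopologicalSpace.SeparableSpace X]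
    {T : X →L[ℂ] Y} (hT : IsContractive T) :
    ∃ (𝔇 : Type u) (_ : NormedAddCommGroup 𝔇) (_ : InnerProductSpace ℂ 𝔇) (_ : CompleteSpace 𝔇)
      (E : 𝔇 →L[ℂ] X), TopologicalSpace.SeparableSpace 𝔇 ∧ IsDefectOperator T E :=
  exists_factorization_of_nonneg (ContinuousLinearMap.id ℂ X - adj T ∘L T)
    (fun x y => by simp [ip_adj, adj_adj])
    (fun x => by simpa [ip_adj_left] using hT x)

/-! ### Julia operators -/

section Defect

variable {𝔇 : Type*} [NormedAddCommGroup 𝔇] [InnerProductSpace ℂ 𝔇] [CompleteSpace 𝔇]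
  {𝔇' : Type*} [NormedAddCommGroup 𝔇'] [InnerProductSpace ℂ 𝔇'] [CompleteSpace 𝔇']
  {T : X →L[ℂ] Y} {E : 𝔇 →L[ℂ] X} {E' : 𝔇' →L[ℂ] Y}

theorem IsDefectOperator.apply (h : IsDefectOperator T E) (x : X) :
    E (adj E x) = x - adj T (T x) :=
  (DFunLike.congr_fun h.2 x).symm

/-- The orthogonal complement of the range of `E*` is the kernel of `E`, which is zero. Hence
operators on `𝔇` may be defined and compared on vectors `E* x`. -/
theorem IsDefectOperator.denseRange_adj (h : IsDefectOperator T E) : DenseRange (adj E) := by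
  have h1 : (LinearMap.range (adj E).toLinearMap)ᗮ = ⊥ := by
    refine (Submodule.eq_bot_iff _).2 fun k hk => h.1 ?_
    rw [map_zero]
    refine eq_of_ip_eq fun x => ?_
    rw [map_zero, ← ip_adj_left]
    exact (Submodule.mem_orthogonal _ _).1 hk _ ⟨x, rfl⟩
  have h2 := Submodule.topologicalClosure_eq_top_iff.2 h1
  rw [← Submodule.dense_iff_topologicalClosure_eq_top] at h2
  exact h2

/-- The entry completing `T` and its two defect operators to a unitary (Julia) operator. -/
theorem IsDefectOperator.exists_julia (h : IsDefectOperator T E) (h' : IsDefectOperator (adj T) E') :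
    ∃ L : 𝔇' →L[ℂ] 𝔇, (∀ f, E (L f) = -adj T (E' f)) ∧ (∀ f, E' (adj L f) = -T (E f)) ∧
      (∀ y, L (adj E' y) = -adj E (adj T y)) ∧ (∀ x, adj L (adj E x) = -adj E' (T x)) ∧
      (∀ f, adj E (E f) + L (adj L f) = f) ∧ (∀ f, adj E' (E' f) + adj L (L f) = f) := by
  -- This makes `E* x ↦ -E'* T x` well defined and bounded.
  have hb : ∃ C, ∀ x, ‖(-(adj E' ∘L T)) x‖ ≤ C * ‖adj E x‖ := by
    -- By `e1` and `e3` the squared norms compare with factor `1 + ‖E*E‖`, which is at most its own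
    -- square.
    refine ⟨1 + ‖adj E ∘L E‖, fun x => ?_⟩
    refine abs_le_of_sq_le_sq' ?_ (by positivity) |>.2
    -- Uses `(I - TT*)T = T(I - T*T)` and `T*T = I - EE*`.
    have e1 : (inner ℂ (adj E' (T x)) (adj E' (T x)) : ℂ) =
        inner ℂ (adj E x) (adj E x) - inner ℂ (adj E x) ((adj E ∘L E) (adj E x)) := by
      rw [← ip_hilbert, ← ip_hilbert, ← ip_hilbert, ContinuousLinearMap.comp_apply]
      simp only [ip_adj_left, h.apply, h'.apply, adj_adj, map_sub, ip_adj T]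
      ring
    have e2 := congrArg Complex.re e1
    rw [Complex.sub_re] at e2
    have n1 := norm_sq_eq_re_inner (𝕜 := ℂ) (adj E' (T x))
    have n2 := norm_sq_eq_re_inner (𝕜 := ℂ) (adj E x)
    simp only [RCLike.re_to_complex] at n1 n2
    have e3 : |(inner ℂ (adj E x) ((adj E ∘L E) (adj E x))).re| ≤
        ‖adj E ∘L E‖ * ‖adj E x‖ ^ 2 := by
      refine (Complex.abs_re_le_norm _).trans ((norm_inner_le_norm _ _).trans ?_)
      have := mul_le_mul_of_nonneg_left ((adj E ∘L E).le_opNorm (adj E x)) (norm_nonneg (adj E x))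
      linarith
    have e4 := (abs_le.1 e3).1
    have e5 : ‖(-(adj E' ∘L T)) x‖ = ‖adj E' (T x)‖ := by simp
    rw [e5, n1, e2, ← n2, mul_pow]
    nlinarith [mul_nonneg (norm_nonneg (adj E ∘L E)) (sq_nonneg ‖adj E x‖),
      mul_nonneg (sq_nonneg ‖adj E ∘L E‖) (sq_nonneg ‖adj E x‖)]
  let M : 𝔇 →L[ℂ] 𝔇' :=
    (-(adj E' ∘L T)).toLinearMap.extendOfNorm (adj E).toLinearMap
  have hM : ∀ x, M (adj E x) = -adj E' (T x) := fun x =>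
    LinearMap.extendOfNorm_eq (f := (-(adj E' ∘L T)).toLinearMap) (e := (adj E).toLinearMap)
      h.denseRange_adj hb x
  have hc : ∀ f, E (adj M f) = -adj T (E' f) := fun f => eq_of_ip_eq fun x => by
    rw [← ip_adj_left, ← ip_adj, hM, map_neg, map_neg, LinearMap.neg_apply, ip_adj_left, ip_adj]
  have hd : ∀ f, E' (M f) = -T (E f) := by
    have h1 : ∀ x, E' (M (adj E x)) = -T (E (adj E x)) := fun x => by
      simp [hM, h.apply, h'.apply, adj_adj]
    have h2 := h.denseRange_adj.equalizer (E' ∘L M).continuous (-(T ∘L E)).continuous (funext h1)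
    exact congrFun h2
  -- The last two identities are checked after applying the injective `E` and `E'`.
  refine ⟨adj M, hc, by rwa [adj_adj], fun y => eq_of_ip_eq fun f => ?_, by rwa [adj_adj],
    fun f => h.1 ?_, fun f => h'.1 ?_⟩
  · rw [← ip_adj, ← ip_adj, hd, map_neg, map_neg, LinearMap.neg_apply, ip_adj, ip_adj]
  · rw [map_add, h.apply, hc, adj_adj, hd]
    simp
  · rw [map_add, h'.apply, adj_adj, adj_adj, hd, hc]
    simp

end Defect

/-! ### Negative indices -/

/-- The dimension of a negative definite subspace is at most the negative index. -/
theorem HasNegativeIndex.finrank_le {k : ℕ} (h : HasNegativeIndex X k) {W : Type*}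
    [AddCommGroup W] [Module ℂ W] (F : W →ₗ[ℂ] X)
    (hF : ∀ w, w ≠ 0 → (ip (F w) (F w)).re < 0) : Module.finrank ℂ W ≤ k := by
  obtain ⟨P, N, hd, hN, rfl⟩ := h
  -- The projection onto `N` along `P` has kernel `P`, where the form is nonnegative, so it is
  -- injective on a negative subspace.
  refine LinearMap.finrank_le_finrank_of_injective
    (f := (N.projectionOnto P hd.isCompl.symm).comp F) ?_
  refine (injective_iff_map_eq_zero _).2 fun w hw => ?_
  by_contra h0
  rw [LinearMap.comp_apply, ← LinearMap.mem_ker, Submodule.ker_projectionOnto] at hw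
  exact (hF w h0).not_ge (hd.re_nonneg hw)

theorem HasNegativeIndex.prod {k l : ℕ} (h : HasNegativeIndex X k) (h' : HasNegativeIndex Y l) :
    HasNegativeIndex (X × Y) (k + l) := by
  obtain ⟨P, N, hd, hN, rfl⟩ := h
  obtain ⟨P', N', hd', hN', rfl⟩ := h'
  let e : N.prod N' ≃ₗ[ℂ] N × N' :=
    { toFun := fun z => (⟨z.1.1, z.2.1⟩, ⟨z.1.2, z.2.2⟩)
      map_add' := fun _ _ => rfl
      map_smul' := fun _ _ => rfl
      invFun := fun z => ⟨(z.1, z.2), z.1.2, z.2.2⟩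
      left_inv := fun _ => rfl
      right_inv := fun _ => rfl }
  refine ⟨_, _, isFundamentalDecomposition_prod hd hd', Module.Finite.equiv e.symm, ?_⟩
  rw [e.finrank_eq, Module.finrank_prod]

/-- Positivity of the form forces `N = ⊥` in any fundamental decomposition. -/
theorem hasNegativeIndex_hilbert (H : Type*) [NormedAddCommGroup H] [InnerProductSpace ℂ H]
    [CompleteSpace H] : HasNegativeIndex H 0 := by
  obtain ⟨P, N, hd, hN⟩ := exists_decomposition (X := H)
  refine ⟨P, N, hd, hN, ?_⟩
  have : N = ⊥ := (Submodule.eq_bot_iff N).2 fun n hn => by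
    by_contra h0
    exact (hd.re_neg hn h0).not_ge (inner_self_nonneg (𝕜 := ℂ))
  rw [this, finrank_bot]

/-- The adjoint of a contraction between Pontryagin spaces of the same negative index is
contractive. -/
theorem IsContractive.adj {T : X →L[ℂ] Y} {k : ℕ} (hX : HasNegativeIndex X k)
    (hY : HasNegativeIndex Y k) {𝔇 : Type*} [NormedAddCommGroup 𝔇] [InnerProductSpace ℂ 𝔇]
    [CompleteSpace 𝔇] {E : 𝔇 →L[ℂ] X} (h : IsDefectOperator T E) :
    IsContractive (PontryaginSpace.adj T) := by
  intro y
  -- `T*T + EE* = I` makes `V` isometric. The vector `w` below is the component of `(y, 0)`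
  -- orthogonal to the range of `V`, and `⟨w, w⟩ = ⟨y, y⟩ - ⟨T*y, T*y⟩`.
  let V : X →L[ℂ] Y × 𝔇 := T.prod (PontryaginSpace.adj E)
  have hV : ∀ x, PontryaginSpace.adj V (V x) = x := fun x => eq_of_ip_eq fun z => by
    rw [← ip_adj, ip_prod]
    change ip (T z) (T x) + ip (PontryaginSpace.adj E z) (PontryaginSpace.adj E x) = _
    rw [ip_adj_left, h.apply, map_sub, ip_adj]
    ring
  have hVy : PontryaginSpace.adj V (y, 0) = PontryaginSpace.adj T y := eq_of_ip_eq fun z => by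
    rw [← ip_adj, ip_prod, ← ip_adj]
    change ip (T z) y + ip _ (0 : 𝔇) = _
    rw [map_zero, add_zero]
  let w : Y × 𝔇 := (y, 0) - V (PontryaginSpace.adj V (y, 0))
  have hw : ∀ x, ip (V x) w = 0 := fun x => by
    rw [ip_adj, map_sub, hV, sub_self, map_zero]
  have hw' : ∀ x, ip w (V x) = 0 := fun x => by rw [← conj_symm, hw, map_zero]
  have hww : ip w w = ip y y - ip (PontryaginSpace.adj T y) (PontryaginSpace.adj T y) := by
    have e1 : ip w w = ip w ((y, 0) : Y × 𝔇) := by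
      change ip w ((y, 0) - V _) = _
      rw [map_sub, hw', sub_zero]
    rw [e1]
    change ip ((y, 0) - V _) ((y, 0) : Y × 𝔇) = _
    rw [map_sub, LinearMap.sub_apply, ip_adj, hVy, ip_prod]
    simp
  by_contra hneg
  have hneg' : (ip w w).re < 0 := by
    rw [hww, Complex.sub_re]
    linarith [not_le.1 hneg]
  obtain ⟨P, N, hd, hN, hk⟩ := hX
  -- If `⟨w, w⟩ < 0`, then `V N` and `w` span a negative subspace of dimension `k + 1`, but `Y × 𝔇`
  -- has negative index `k`.
  let F : N × ℂ →ₗ[ℂ] Y × 𝔇 :=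
    (V.toLinearMap ∘ₗ N.subtype).coprod (LinearMap.toSpanSingleton ℂ _ w)
  have hF : ∀ n : N, ∀ c : ℂ, F (n, c) = V n + c • w := fun n c => rfl
  have h2 := (hY.prod (hasNegativeIndex_hilbert 𝔇)).finrank_le F ?_
  · rw [Module.finrank_prod, Module.finrank_self, hk] at h2
    omega
  · rintro ⟨n, c⟩ hnc
    have e1 : ip (F (n, c)) (F (n, c)) = ip (n : X) (n : X) + (conj c * c) * ip w w := by
      simp only [hF, map_add, map_smul, LinearMap.add_apply, LinearMap.map_smulₛₗ,
        LinearMap.smul_apply, hw, hw', smul_eq_mul]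
      rw [ip_adj, hV]
      ring
    have e2 : (conj c * c) = ((‖c‖ ^ 2 : ℝ) : ℂ) := by
      rw [mul_comm, Complex.mul_conj, Complex.normSq_eq_norm_sq]
    rw [e1, e2, Complex.add_re, Complex.re_ofReal_mul]
    by_cases hn : n = 0
    · have hc : c ≠ 0 := fun hc => hnc (by rw [hn, hc]; rfl)
      have : 0 < ‖c‖ ^ 2 := by positivity
      rw [hn]
      simp only [ZeroMemClass.coe_zero, map_zero, Complex.zero_re, zero_add]
      exact mul_neg_of_pos_of_neg this hneg'
    · have := hd.re_neg n.2 (fun h => hn (Subtype.ext h))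
      have h3 : ‖c‖ ^ 2 * (ip w w).re ≤ 0 :=
        mul_nonpos_of_nonneg_of_nonpos (by positivity) hneg'.le
      linarith

end Adjoint

end PontryaginSpace

/-! ### Square-summable sequences and the shift -/

namespace EllTwo

/-- Each coordinate embedding has separable range, and the span of these countably many ranges is
dense. -/
theorem separableSpace {𝔇 : Type*} [NormedAddCommGroup 𝔇] [NormedSpace ℂ 𝔇]
    [TopologicalSpace.SeparableSpace 𝔇] :
    TopologicalSpace.SeparableSpace (EllTwo 𝔇) := by
  have h1 : TopologicalSpace.IsSeparable
      (⋃ n : ℕ, Set.range (lp.single (E := fun _ : ℕ => 𝔇) 2 n)) :=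
    .iUnion fun n => TopologicalSpace.isSeparable_range (lp.isometry_single n).continuous
  refine TopologicalSpace.isSeparable_univ_iff.1 ((h1.span (R := ℂ)).closure.mono fun f _ => ?_)
  refine mem_closure_of_tendsto (lp.hasSum_single ENNReal.ofNat_ne_top f)
    (.of_forall fun t => Submodule.sum_mem _ fun n _ => Submodule.subset_span ?_)
  exact Set.mem_iUnion.2 ⟨n, f n, rfl⟩

/-- The forward shift on `ℓ²(𝔇)`. -/
def shift (𝔇 : Type*) [NormedAddCommGroup 𝔇] [InnerProductSpace ℂ 𝔇] :
    EllTwo 𝔇 →ₗᵢ[ℂ] EllTwo 𝔇 where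
  toFun f := ⟨fun n => Nat.casesOn n 0 f, by
    have h := (memℓp_gen_iff (by simp)).1 (lp.memℓp f)
    refine (memℓp_gen_iff (by simp)).2 ?_
    rwa [← summable_nat_add_iff 1]⟩
  map_add' f g := by
    ext n
    cases n
    · exact (add_zero (0 : 𝔇)).symm
    · rfl
  map_smul' c f := by
    ext n
    cases n
    · exact (smul_zero (A := 𝔇) c).symm
    · rfl
  norm_map' f := by
    rw [lp.norm_eq_tsum_rpow (by simp), lp.norm_eq_tsum_rpow (by simp)]
    congr 1
    rw [Summable.tsum_eq_zero_add]
    · simp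
    · exact (memℓp_gen_iff (by simp)).1 (lp.memℓp _)

variable {𝔇 : Type*} [NormedAddCommGroup 𝔇] [InnerProductSpace ℂ 𝔇]

@[simp]
theorem shift_zero (f : EllTwo 𝔇) : shift 𝔇 f 0 = 0 :=
  rfl

@[simp]
theorem shift_succ (f : EllTwo 𝔇) (n : ℕ) : shift 𝔇 f (n + 1) = f n :=
  rfl

theorem shift_single (n : ℕ) (a : 𝔇) : shift 𝔇 (lp.single 2 n a) = lp.single 2 (n + 1) a := by
  ext m
  cases m <;> simp [lp.single_apply, Pi.single_apply]

open ContinuousLinearMap in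
/-- The forward shift `s` and the embedding `ι` of the first coordinate: `s* s = I`, `ι* ι = I`,
`s* ι = 0`, `ι* s = 0`, `s s* + ι ι* = I`. -/
theorem exists_shift (𝔇 : Type*) [NormedAddCommGroup 𝔇] [InnerProductSpace ℂ 𝔇]
    [CompleteSpace 𝔇] :
    ∃ (s : EllTwo 𝔇 →L[ℂ] EllTwo 𝔇) (ι : 𝔇 →L[ℂ] EllTwo 𝔇), (∀ f, adjoint s (s f) = f) ∧
      (∀ a, adjoint ι (ι a) = a) ∧ (∀ a, adjoint s (ι a) = 0) ∧ (∀ f, adjoint ι (s f) = 0) ∧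
      ∀ f, s (adjoint s f) + ι (adjoint ι f) = f := by
  let s := (shift 𝔇).toContinuousLinearMap
  let ι := lp.singleContinuousLinearMap ℂ (fun _ : ℕ => 𝔇) 2 0
  -- Pairing with `lp.single` reads off coordinates, which identifies `ι*` as evaluation at `0` and
  -- `s*` as the backward shift.
  have hsingle : ∀ (n : ℕ) (a : 𝔇) (f : EllTwo 𝔇),
      inner ℂ (lp.single (E := fun _ : ℕ => 𝔇) 2 n a) f = inner ℂ a (f n) := fun n a f =>
    lp.inner_single_left (G := fun _ : ℕ => 𝔇) n a f
  have hι : ∀ f, adjoint ι f = f 0 := fun f => ext_inner_left ℂ fun a => by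
    rw [adjoint_inner_right]
    exact hsingle 0 a f
  have hs : ∀ f n, adjoint s f n = f (n + 1) := fun f n => ext_inner_left ℂ fun a => by
    refine (hsingle n a _).symm.trans ?_
    rw [adjoint_inner_right]
    refine Eq.trans ?_ (hsingle (n + 1) a f)
    rw [← shift_single]
    rfl
  have hs0 : ∀ f, s f 0 = 0 := fun _ => rfl
  have hs1 : ∀ f n, s f (n + 1) = f n := fun _ _ => rfl
  have hι0 : ∀ a, ι a 0 = a := fun a => lp.single_apply_self (E := fun _ : ℕ => 𝔇) 2 0 a
  have hι1 : ∀ a n, ι a (n + 1) = 0 := fun a n =>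
    lp.single_apply_ne (E := fun _ : ℕ => 𝔇) 2 0 a n.succ_ne_zero
  refine ⟨s, ι, fun f => ?_, fun a => ?_, fun a => ?_, fun f => ?_, fun f => ?_⟩
  · ext n
    rw [hs, hs1]
  · rw [hι, hι0]
  · ext n
    rw [hs, hι1]
    rfl
  · rw [hι, hs0]
  · ext n
    rw [lp.coeFn_add, Pi.add_apply, hι]
    cases n with
    | zero => rw [hs0, hι0, zero_add]
    | succ n => rw [hs1, hι1, hs, add_zero]

end EllTwo

open PontryaginSpace

/-! ### Coupling a Julia operator to shifts -/

namespace LinSystem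

section Blocks

variable {X U Y : Type*} [NormedAddCommGroup X] [NormedSpace ℂ X]
  [NormedAddCommGroup U] [NormedSpace ℂ U] [NormedAddCommGroup Y] [NormedSpace ℂ Y]

/-- The system with a given system operator. -/
def ofOp (W : X × U →L[ℂ] X × Y) : LinSystem X U Y where
  A := .fst ℂ X Y ∘L W ∘L .inl ℂ X U
  B := .fst ℂ X Y ∘L W ∘L .inr ℂ X U
  C := .snd ℂ X Y ∘L W ∘L .inl ℂ X U
  D := .snd ℂ X Y ∘L W ∘L .inr ℂ X U

theorem op_ofOp (W : X × U →L[ℂ] X × Y) : (ofOp W).op = W := by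
  refine ContinuousLinearMap.ext fun ⟨x, u⟩ => ?_
  change W (x, 0) + W (0, u) = W (x, u)
  rw [← map_add, Prod.mk_add_mk, add_zero, zero_add]

variable [CompleteSpace X] [PontryaginSpace X] [CompleteSpace U] [PontryaginSpace U]
  [CompleteSpace Y] [PontryaginSpace Y]

/-- Reads a block of the adjoint off the adjoint of the whole operator, the only one computed
explicitly for the dilation. -/
theorem adj_A_apply (S : LinSystem X U Y) (x : X) : adj S.A x = (adj S.op (x, 0)).1 :=
  eq_of_ip_eq fun z => by
    have h := ip_adj S.op (z, 0) (x, 0)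
    simp only [ip_prod, map_zero, LinearMap.zero_apply, add_zero] at h
    rw [← ip_adj, ← h]
    simp [op]

theorem adj_B_apply (S : LinSystem X U Y) (x : X) : adj S.B x = (adj S.op (x, 0)).2 :=
  eq_of_ip_eq fun z => by
    have h := ip_adj S.op (0, z) (x, 0)
    simp only [ip_prod, map_zero, LinearMap.zero_apply, add_zero, zero_add] at h
    rw [← ip_adj, ← h]
    simp [op]

end Blocks

/-- Coupling a Julia operator of the system operator to two shifts yields a conservative
dilation. -/
theorem exists_dilation_of_julia {X U Y 𝔇 𝔇' 𝒟 𝒟' : Type*}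
    [NormedAddCommGroup X] [NormedSpace ℂ X] [CompleteSpace X] [PontryaginSpace X]
    [NormedAddCommGroup U] [NormedSpace ℂ U] [CompleteSpace U] [PontryaginSpace U]
    [NormedAddCommGroup Y] [NormedSpace ℂ Y] [CompleteSpace Y] [PontryaginSpace Y]
    [NormedAddCommGroup 𝔇] [InnerProductSpace ℂ 𝔇] [CompleteSpace 𝔇]
    [NormedAddCommGroup 𝔇'] [InnerProductSpace ℂ 𝔇'] [CompleteSpace 𝔇']
    [NormedAddCommGroup 𝒟] [InnerProductSpace ℂ 𝒟] [CompleteSpace 𝒟]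
    [NormedAddCommGroup 𝒟'] [InnerProductSpace ℂ 𝒟'] [CompleteSpace 𝒟']
    (S : LinSystem X U Y) {E : 𝔇 →L[ℂ] X × U} {E' : 𝔇' →L[ℂ] X × Y} (L : 𝔇' →L[ℂ] 𝔇)
    (j₁ : ∀ z g, adj S.op (S.op z + E' g) + E (adj E z + L g) = z)
    (j₂ : ∀ z g, adj E' (S.op z + E' g) + adj L (adj E z + L g) = g)
    (j₃ : ∀ z f, S.op (adj S.op z + E f) + E' (adj E' z + adj L f) = z)
    (j₄ : ∀ z f, adj E (adj S.op z + E f) + L (adj E' z + adj L f) = f)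
    {s : 𝒟 →L[ℂ] 𝒟} {ι : 𝔇 →L[ℂ] 𝒟} (ss : ∀ f, adj s (s f) = f) (ιι : ∀ a, adj ι (ι a) = a)
    (sι : ∀ a, adj s (ι a) = 0) (ιs : ∀ f, adj ι (s f) = 0)
    (sum : ∀ f, s (adj s f) + ι (adj ι f) = f)
    {s' : 𝒟' →L[ℂ] 𝒟'} {ι' : 𝔇' →L[ℂ] 𝒟'} (ss' : ∀ f, adj s' (s' f) = f)
    (ιι' : ∀ a, adj ι' (ι' a) = a) (sι' : ∀ a, adj s' (ι' a) = 0) (ιs' : ∀ f, adj ι' (s' f) = 0)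
    (sum' : ∀ f, s' (adj s' f) + ι' (adj ι' f) = f) :
    ∃ S' : LinSystem (𝒟 × X × 𝒟') U Y, S'.IsDilation S ∧ S'.IsConservative := by
  let z : (𝒟 × X × 𝒟') × U →L[ℂ] X × U :=
    (.fst ℂ X 𝒟' ∘L .snd ℂ 𝒟 (X × 𝒟') ∘L .fst ℂ (𝒟 × X × 𝒟') U).prod (.snd ℂ (𝒟 × X × 𝒟') U)
  let z₁ : (𝒟 × X × 𝒟') × Y →L[ℂ] X × Y :=
    (.fst ℂ X 𝒟' ∘L .snd ℂ 𝒟 (X × 𝒟') ∘L .fst ℂ (𝒟 × X × 𝒟') Y).prod (.snd ℂ (𝒟 × X × 𝒟') Y)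
  let δ : (𝒟 × X × 𝒟') × U →L[ℂ] 𝒟 := .fst ℂ 𝒟 (X × 𝒟') ∘L .fst ℂ (𝒟 × X × 𝒟') U
  let δ₁ : (𝒟 × X × 𝒟') × Y →L[ℂ] 𝒟 := .fst ℂ 𝒟 (X × 𝒟') ∘L .fst ℂ (𝒟 × X × 𝒟') Y
  let δ' : (𝒟 × X × 𝒟') × U →L[ℂ] 𝒟' :=
    .snd ℂ X 𝒟' ∘L .snd ℂ 𝒟 (X × 𝒟') ∘L .fst ℂ (𝒟 × X × 𝒟') U
  let δ₁' : (𝒟 × X × 𝒟') × Y →L[ℂ] 𝒟' :=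
    .snd ℂ X 𝒟' ∘L .snd ℂ 𝒟 (X × 𝒟') ∘L .fst ℂ (𝒟 × X × 𝒟') Y
  -- `t` is the `X ⊕ Y` output of the Julia operator, fed with the first entry of the `𝒟'`
  -- component. `r` is the analogous output of its adjoint.
  let t := S.op ∘L z + E' ∘L adj ι' ∘L δ'
  let r := adj S.op ∘L z₁ + E ∘L adj ι ∘L δ₁
  let W : (𝒟 × X × 𝒟') × U →L[ℂ] (𝒟 × X × 𝒟') × Y :=
    ((s ∘L δ + ι ∘L (adj E ∘L z + L ∘L adj ι' ∘L δ')).prod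
      ((.fst ℂ X Y ∘L t).prod (adj s' ∘L δ'))).prod (.snd ℂ X Y ∘L t)
  -- The same coupling run backwards: `s*` and `s'` replace `s` and `s'*`, and the adjoint Julia
  -- operator replaces the Julia operator.
  let R : (𝒟 × X × 𝒟') × Y →L[ℂ] (𝒟 × X × 𝒟') × U :=
    ((adj s ∘L δ₁).prod ((.fst ℂ X U ∘L r).prod
      (s' ∘L δ₁' + ι' ∘L (adj E' ∘L z₁ + adj L ∘L adj ι ∘L δ₁)))).prod (.snd ℂ X U ∘L r)
  have hW : ∀ d x d' u, W ((d, x, d'), u) =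
      ((s d + ι (adj E (x, u) + L (adj ι' d')), (S.op (x, u) + E' (adj ι' d')).1, adj s' d'),
        (S.op (x, u) + E' (adj ι' d')).2) := fun _ _ _ _ => rfl
  have hR : ∀ d x d' y, R ((d, x, d'), y) =
      ((adj s d, (adj S.op (x, y) + E (adj ι d)).1,
        s' d' + ι' (adj E' (x, y) + adj L (adj ι d))),
        (adj S.op (x, y) + E (adj ι d)).2) := fun _ _ _ _ => rfl
  have hadj : adj W = R := adj_unique fun ⟨⟨d, x, d'⟩, u⟩ ⟨⟨e, x₁, e'⟩, y⟩ => by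
    -- State and output pairings must be regrouped into one pairing on the product, since `S.op` and
    -- `E'` move across only there.
    have h1 : ∀ q : X × Y, ip q.1 x₁ + ip q.2 y = ip q (x₁, y) := fun _ => rfl
    have h2 : ∀ q : X × U, ip x q.1 + ip u q.2 = ip (x, u) q := fun _ => rfl
    have h3 := h1 (S.op (x, u) + E' (adj ι' d'))
    have h4 := h2 (adj S.op (x₁, y) + E (adj ι e))
    rw [hW, hR]
    simp only [ip_prod (X := 𝒟 × X × 𝒟'), ip_prod (X := 𝒟), ip_prod (X := X) (Y := 𝒟')]
    simp only [map_add, LinearMap.add_apply, ip_adj, adj_adj] at h3 h4 ⊢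
    linear_combination h3 - h4
  have hRW : ∀ v, R (W v) = v := fun ⟨⟨d, x, d'⟩, u⟩ => by
    rw [hW, hR]
    -- The range of `s` is invisible to `ι*`, so the Julia output is recovered exactly and `j₁`,
    -- `j₂` invert it.
    have hd : adj ι (s d + ι (adj E (x, u) + L (adj ι' d'))) = adj E (x, u) + L (adj ι' d') := by
      rw [map_add, ιs, ιι, zero_add]
    simp only [hd, Prod.mk.eta, j₁, j₂, sum']
    rw [map_add, ss, sι, add_zero]
  have hWR : ∀ v, W (R v) = v := fun ⟨⟨d, x, d'⟩, y⟩ => by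
    rw [hR, hW]
    have hd : adj ι' (s' d' + ι' (adj E' (x, y) + adj L (adj ι d))) =
        adj E' (x, y) + adj L (adj ι d) := by
      rw [map_add, ιs', ιι', zero_add]
    simp only [hd, Prod.mk.eta, j₃, j₄, sum]
    rw [map_add, ss', sι', add_zero]
  have hA : ∀ q, (ofOp W).A q = (W (q, 0)).1 := fun _ => rfl
  have hB : ∀ u, (ofOp W).B u = (W (0, u)).1 := fun _ => rfl
  have hC : ∀ q, (ofOp W).C q = (W (q, 0)).2 := fun _ => rfl
  have hD : ∀ u, (ofOp W).D u = (W (0, u)).2 := fun _ => rfl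
  have z1 : ((0, 0) : X × U) = 0 := rfl
  have z2 : ((0, 0) : X × Y) = 0 := rfl
  have z3 : (0 : 𝒟 × X × 𝒟') = (0, 0, 0) := rfl
  refine ⟨ofOp W, ⟨fun x => ?_, fun u => ?_, fun x => ?_, ?_, fun d => ⟨s d, ?_⟩, fun d => ?_,
    fun d => ⟨s' d, ?_⟩, fun d => ?_⟩, ?_, ?_⟩
  · rw [hA, hW]
    simp [op]
  · rw [hB, z3, hW]
    simp [op]
  · rw [hC, hW]
    simp [op]
  · ext u
    rw [hD, z3, hW]
    simp [op]
  · rw [hA, hW]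
    simp [z1]
  · rw [hC, hW]
    simp [z1]
  · rw [adj_A_apply, op_ofOp, hadj, hR]
    simp [z2]
  · rw [adj_B_apply, op_ofOp, hadj, hR]
    simp [z2]
  · rw [IsIsometric, op_ofOp, hadj]
    exact ContinuousLinearMap.ext hRW
  · rw [IsCoisometric, op_ofOp, hadj]
    exact ContinuousLinearMap.ext hWR

end LinSystem

end

/-! ### Assembling the dilation -/

theorem mainTheorem7 {X : Type u} {U : Type v} {Y : Type w}
    [NormedAddCommGroup X] [NormedSpace ℂ X] [CompleteSpace X] [PontryaginSpace X]
    [NormedAddCommGroup U] [NormedSpace ℂ U] [CompleteSpace U] [PontryaginSpace U]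
    [NormedAddCommGroup Y] [NormedSpace ℂ Y] [CompleteSpace Y] [PontryaginSpace Y]
    [TopologicalSpace.SeparableSpace X] [TopologicalSpace.SeparableSpace U]
    [TopologicalSpace.SeparableSpace Y]
    (κ : ℕ) (hX : PontryaginSpace.HasNegativeIndex X κ)
    (ν : ℕ) (hU : PontryaginSpace.HasNegativeIndex U ν) (hY : PontryaginSpace.HasNegativeIndex Y ν)
    (S : LinSystem X U Y) (hS : S.IsPassive) :
    ∃ (𝔇 : Type (max u v)) (_ : NormedAddCommGroup 𝔇) (_ : InnerProductSpace ℂ 𝔇)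
      (_ : CompleteSpace 𝔇) (E : 𝔇 →L[ℂ] X × U)
      (𝔇' : Type (max u w)) (_ : NormedAddCommGroup 𝔇') (_ : InnerProductSpace ℂ 𝔇')
      (_ : CompleteSpace 𝔇') (E' : 𝔇' →L[ℂ] X × Y)
      (S' : LinSystem (EllTwo 𝔇 × X × EllTwo 𝔇') U Y),
      PontryaginSpace.IsDefectOperator S.op E ∧ PontryaginSpace.IsDefectOperator (PontryaginSpace.adj S.op) E' ∧
      TopologicalSpace.SeparableSpace (EllTwo 𝔇 × X × EllTwo 𝔇') ∧
      PontryaginSpace.HasNegativeIndex (EllTwo 𝔇 × X × EllTwo 𝔇') κ ∧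
      S'.IsDilation S ∧ S'.IsConservative := by
  obtain ⟨𝔇, _, _, _, E, _, hE⟩ :=
    PontryaginSpace.IsContractive.exists_isDefectOperator hS
  -- Domain and codomain of `S.op` both have negative index `κ + ν`.
  obtain ⟨𝔇', _, _, _, E', _, hE'⟩ :=
    (PontryaginSpace.IsContractive.adj (hX.prod hU) (hX.prod hY) hE).exists_isDefectOperator
  obtain ⟨L, a₁, a₂, a₃, a₄, a₅, a₆⟩ := hE.exists_julia hE'
  obtain ⟨s, ι, b₁, b₂, b₃, b₄, b₅⟩ := EllTwo.exists_shift 𝔇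
  obtain ⟨s', ι', c₁, c₂, c₃, c₄, c₅⟩ := EllTwo.exists_shift 𝔇'
  simp only [← PontryaginSpace.adj_hilbert] at b₁ b₂ b₃ b₄ b₅ c₁ c₂ c₃ c₄ c₅
  obtain ⟨S', h₁, h₂⟩ := S.exists_dilation_of_julia (E := E) (E' := E') L
    (fun z g => by
      simp only [map_add, hE.apply, a₁]
      abel)
    (fun z g => by
      rw [map_add, map_add, a₄]
      -- The third `g` is the whole right-hand side.
      nth_rewrite 3 [← a₆ g]
      abel)
    (fun z f => by
      simp only [map_add, hE'.apply, a₂, PontryaginSpace.adj_adj]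
      abel)
    (fun z f => by
      rw [map_add, map_add, a₃]
      nth_rewrite 3 [← a₅ f]
      abel)
    b₁ b₂ b₃ b₄ b₅ c₁ c₂ c₃ c₄ c₅
  refine ⟨𝔇, _, _, _, E, 𝔇', _, _, _, E', S', hE, hE', ?_, ?_, h₁, h₂⟩
  · have := EllTwo.separableSpace (𝔇 := 𝔇)
    have := EllTwo.separableSpace (𝔇 := 𝔇')
    infer_instance
  · have h := (PontryaginSpace.hasNegativeIndex_hilbert (EllTwo 𝔇)).prod
      (hX.prod (PontryaginSpace.hasNegativeIndex_hilbert (EllTwo 𝔇')))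
    rwa [add_zero, zero_add] at h
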